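/- Let $k \ge 1$ and let $Q_k$ be the $k$-dimensional hypercube: its vertices are the $2^k$ binary strings of length $k$, two of them being adjacent when they differ in exactly one coordinate. For a set $S$ of vertices, a vertex $x \in S$ is called full in the induced subgraph $Q_k[S]$ if its degree in $Q_k[S]$ is $k$. For $1 \le n \le 2^k$ let $\phi_k(n)$ be the maximum number of full vertices of $Q_k[S]$ over all sets $S$ of exactly $n$ vertices of $Q_k$. For integers $m, j \ge 1$ there is a unique representation $m = \binom{a_j}{j} + \binom{a_{j-1}}{j-1} + \cdots + \binom{a_p}{p}$ with $a_j > a_{j-1} > \cdots > a_p \ge p \ge 1$; put $m^{(j)} = \binom{a_j}{j+1} + \binom{a_{j-1}}{j} + \cdots + \binom{a_p}{p+1}$. Put also $0^{(j)} = 0$ for every $j \ge 0$. Theorem. Let $1 \le n < 2^k$. Then there are unique integers $i \ge 0$ and $m$ with $n = \sum_{\ell=0}^{i} \binom{k}{\ell} + m$ and $0 \le m < \binom{k}{i+1}$, and for these $$\phi_k(n) = \sum_{\ell=0}^{i-1} \binom{k}{\ell} + m^{(k-i-1)}.$$ Moreover, $\phi_k(2^k) = 2^k$. -/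

import Mathlib

open Finset

/-- The hypercube `Q_k`: its vertices are the binary strings of length `k`, and two of them are
adjacent when they differ in exactly one coordinate. -/
def hypercube (k : ℕ) : SimpleGraph (Fin k → Bool) where
  Adj x y := hammingDist x y = 1
  symm := ⟨fun x y h => by rw [hammingDist_comm]; exact h⟩
  loopless := ⟨fun x h => by simp at h⟩

instance hypercubeDecidableAdj (k : ℕ) : DecidableRel (hypercube k).Adj :=
  fun x y => inferInstanceAs (Decidable (hammingDist x y = 1))

/-- The number of full vertices of the induced subgraph `Q_k[S]`, that is, of vertices whose degree
in `Q_k[S]` is `k`. -/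
def fullCount (k : ℕ) (S : Finset (Fin k → Bool)) : ℕ :=
  #{x : (S : Set (Fin k → Bool)) | ((hypercube k).induce (S : Set (Fin k → Bool))).degree x = k}

/-- `φ_k(n)`: the maximum number of full vertices of `Q_k[S]`, over all sets `S` of `n` vertices
of `Q_k` (there is such a set if and only if `n ≤ 2 ^ k`). -/
def maxFull (k n : ℕ) : ℕ :=
  (powersetCard n (univ : Finset (Fin k → Bool))).sup (fullCount k)

/-- `i`, `m` give the hypercube representation of `n`:
`n = C(k,0) + ⋯ + C(k,i) + m` with `0 ≤ m < C(k,i+1)`. -/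
def IsHCR (k n i m : ℕ) : Prop :=
  n = (∑ l ∈ range (i + 1), k.choose l) + m ∧ m < k.choose (i + 1)

/-- `j` and `a` give the binomial representation of `m` with top index `i`:
`m = C(a_i,i) + C(a_{i-1},i-1) + ⋯ + C(a_j,j)` where `a_i > a_{i-1} > ⋯ > a_j ≥ j ≥ 1`.
Only the values of `a` on `{j, …, i}` matter. -/
structure IsUBR (m i j : ℕ) (a : ℕ → ℕ) : Prop where
  one_le : 1 ≤ j
  le_top : j ≤ i
  le_last : j ≤ a j
  lt_succ : ∀ l, j ≤ l → l < i → a l < a (l + 1)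
  sum_eq : m = ∑ l ∈ Icc j i, (a l).choose l

open Classical in
/-- The upper `i`-boundary `m^{(i)}`: if `m = C(a_i,i) + ⋯ + C(a_j,j)` is the binomial
representation of `m`, then `m^{(i)} = C(a_i,i+1) + ⋯ + C(a_j,j+1)`. For `m ≥ 1` and `i ≥ 1` the
representation exists and is unique (`exists_isUBR`, `IsUBR.unique`). The number `0` is the empty
sum, and `0^{(i)} = 0` for every `i`, including `i = 0`. -/
noncomputable def upperBoundary (m i : ℕ) : ℕ :=
  if h : ∃ p : ℕ × (ℕ → ℕ), IsUBR m i p.1 p.2 then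
    ∑ l ∈ Icc h.choose.1 i, (h.choose.2 l).choose (l + 1)
  else 0

theorem IsUBR.le_apply {m i j : ℕ} {a : ℕ → ℕ} (h : IsUBR m i j a) {l : ℕ} (hj : j ≤ l)
    (hl : l ≤ i) : l ≤ a l := by
  induction l, hj using Nat.le_induction with
  | base => exact h.le_last
  | succ l hj ih =>
    have h1 := h.lt_succ l hj (by omega)
    have h2 := ih (by omega)
    omega

theorem IsUBR.choose_le {m i j : ℕ} {a : ℕ → ℕ} (h : IsUBR m i j a) :
    (a i).choose i ≤ m := by
  rw [h.sum_eq]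
  exact single_le_sum (f := fun l => (a l).choose l) (fun _ _ => Nat.zero_le _)
    (mem_Icc.2 ⟨h.le_top, le_rfl⟩)

theorem IsUBR.pos {m i j : ℕ} {a : ℕ → ℕ} (h : IsUBR m i j a) : 0 < m :=
  lt_of_lt_of_le (Nat.choose_pos (h.le_apply h.le_top le_rfl)) h.choose_le

/-- Dropping the leading term of a binomial representation. -/
theorem IsUBR.tail {m i j : ℕ} {a : ℕ → ℕ} (h : IsUBR m (i + 1) j a) (hj : j ≤ i) :
    ∃ r, IsUBR r i j a ∧ m = r + (a (i + 1)).choose (i + 1) :=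
  ⟨∑ l ∈ Icc j i, (a l).choose l,
    ⟨h.one_le, hj, h.le_last, fun l h1 h2 => h.lt_succ l h1 (by omega), rfl⟩, by
    rw [h.sum_eq, sum_Icc_succ_top (by omega)]⟩

theorem IsUBR.lt_choose {m i j : ℕ} {a : ℕ → ℕ} (h : IsUBR m i j a) :
    m < (a i + 1).choose i := by
  induction i generalizing m with
  | zero => have := h.one_le; have := h.le_top; omega
  | succ i ih =>
    rcases Nat.lt_or_ge i j with hij | hij
    · have hji : j = i + 1 := by have := h.le_top; omega
      have hm := h.sum_eq
      have h1 := h.le_apply h.le_top le_rfl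
      rw [hji, Icc_self, sum_singleton] at hm
      have h2 : 0 < (a (i + 1)).choose i := Nat.choose_pos (by omega)
      rw [Nat.choose_succ_succ, Nat.succ_eq_add_one]
      omega
    · obtain ⟨r, hr, hm⟩ := h.tail hij
      have h1 := ih hr
      have h2 : (a i + 1).choose i ≤ (a (i + 1)).choose i :=
        Nat.choose_le_choose i (h.lt_succ i hij (by omega))
      rw [Nat.choose_succ_succ, Nat.succ_eq_add_one]
      omega

/-- The binomial representation is unique. -/
theorem IsUBR.unique {m i j j' : ℕ} {a a' : ℕ → ℕ} (h : IsUBR m i j a) (h' : IsUBR m i j' a') :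
    j = j' ∧ ∀ l, j ≤ l → l ≤ i → a l = a' l := by
  have key : ∀ {b b' : ℕ → ℕ} {p p' : ℕ}, IsUBR m i p b → IsUBR m i p' b' → b i ≤ b' i := by
    intro b b' p p' hb hb'
    by_contra hlt
    have h1 := Nat.choose_le_choose i (by omega : b' i + 1 ≤ b i)
    have h2 := hb.choose_le
    have h3 := hb'.lt_choose
    omega
  have htop : a i = a' i := le_antisymm (key h h') (key h' h)
  clear key
  induction i generalizing m with
  | zero => have := h.one_le; have := h.le_top; omega
  | succ i ih =>
    have hj := h.le_top
    have hj' := h'.le_top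
    rcases Nat.lt_or_ge i j with hij | hij <;> rcases Nat.lt_or_ge i j' with hij' | hij'
    · refine ⟨by omega, fun l h1 h2 => ?_⟩
      obtain rfl : l = i + 1 := by omega
      exact htop
    · obtain ⟨r, hr, hm⟩ := h'.tail hij'
      have hm' := h.sum_eq
      have h0 := hr.pos
      rw [show j = i + 1 by omega, Icc_self, sum_singleton, htop] at hm'
      omega
    · obtain ⟨r, hr, hm⟩ := h.tail hij
      have hm' := h'.sum_eq
      have h0 := hr.pos
      rw [show j' = i + 1 by omega, Icc_self, sum_singleton, ← htop] at hm'
      omega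
    · obtain ⟨r, hr, hm⟩ := h.tail hij
      obtain ⟨r', hr', hm'⟩ := h'.tail hij'
      obtain rfl : r = r' := by rw [htop] at hm; omega
      have key : ∀ {b b' : ℕ → ℕ} {p p' : ℕ}, IsUBR r i p b → IsUBR r i p' b' → b i ≤ b' i := by
        intro b b' p p' hb hb'
        by_contra hlt
        have h1 := Nat.choose_le_choose i (by omega : b' i + 1 ≤ b i)
        have h2 := hb.choose_le
        have h3 := hb'.lt_choose
        omega
      obtain ⟨e, he⟩ := ih hr hr' (le_antisymm (key hr hr') (key hr' hr))
      refine ⟨e, fun l h1 h2 => ?_⟩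
      rcases Nat.lt_or_ge i l with hl | hl
      · obtain rfl : l = i + 1 := by omega
        exact htop
      · exact he l h1 hl

/-- The binomial representation exists. -/
theorem exists_isUBR {m i : ℕ} (hm : 1 ≤ m) (hi : 1 ≤ i) : ∃ j a, IsUBR m i j a := by
  induction i, hi using Nat.le_induction generalizing m with
  | base =>
    exact ⟨1, fun _ => m, le_rfl, le_rfl, hm, fun l h1 h2 => by omega, by simp⟩
  | succ i hi ih =>
    have hex : ∃ b : ℕ, m < b.choose (i + 1) := by
      refine ⟨m + 1 + i, ?_⟩
      clear hm
      induction m with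
      | zero => exact Nat.choose_pos (by omega)
      | succ m ihm =>
        have h1 : 0 < (m + 1 + i).choose i := Nat.choose_pos (by omega)
        rw [show m + 1 + 1 + i = (m + 1 + i) + 1 by omega, Nat.choose_succ_succ, Nat.succ_eq_add_one]
        omega
    obtain ⟨c, hc⟩ : ∃ c, Nat.find hex = c + 1 := by
      refine Nat.exists_eq_succ_of_ne_zero fun h0 => ?_
      have := Nat.find_spec hex
      rw [h0] at this
      simp at this
    have h1 : m < (c + 1).choose (i + 1) := hc ▸ Nat.find_spec hex
    have h2 : c.choose (i + 1) ≤ m := not_lt.1 (Nat.find_min hex (by omega))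
    have h3 : i + 1 ≤ c := by
      by_contra hlt
      have h4 := Nat.choose_le_choose (i + 1) (by omega : c + 1 ≤ i + 1)
      rw [Nat.choose_self] at h4
      omega
    rw [Nat.choose_succ_succ, Nat.succ_eq_add_one] at h1
    obtain ⟨r, rfl⟩ := Nat.exists_eq_add_of_le h2
    rcases Nat.eq_zero_or_pos r with rfl | hr
    · exact ⟨i + 1, fun _ => c, by omega, le_rfl, h3, fun l h4 h5 => by omega, by simp⟩
    · obtain ⟨j, a, ha⟩ := ih hr
      have hji := ha.le_top
      have hlt : a i < c := by
        by_contra hge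
        have h4 := Nat.choose_le_choose i (by omega : c ≤ a i)
        have h5 := ha.choose_le
        omega
      refine ⟨j, fun l => if l ≤ i then a l else c, ha.one_le, by omega, ?_, ?_, ?_⟩
      · simpa [hji] using ha.le_last
      · intro l h4 h5
        rcases Nat.lt_or_ge l i with h6 | h6
        · simpa [h6.le, Nat.succ_le_of_lt h6] using ha.lt_succ l h4 h6
        · obtain rfl : l = i := by omega
          simpa using hlt
      · rw [sum_Icc_succ_top (by omega), add_comm]
        congr 1
        · rw [ha.sum_eq]
          exact sum_congr rfl fun l hl => by simp [(mem_Icc.1 hl).2]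
        · simp

theorem IsUBR.upperBoundary_eq {m i j : ℕ} {a : ℕ → ℕ} (h : IsUBR m i j a) :
    upperBoundary m i = ∑ l ∈ Icc j i, (a l).choose (l + 1) := by
  have hex : ∃ p : ℕ × (ℕ → ℕ), IsUBR m i p.1 p.2 := ⟨(j, a), h⟩
  rw [upperBoundary, dif_pos hex]
  obtain ⟨e, he⟩ := h.unique hex.choose_spec
  rw [← e]
  exact sum_congr rfl fun l hl => by rw [he l (mem_Icc.1 hl).1 (mem_Icc.1 hl).2]

theorem upperBoundary_zero (i : ℕ) : upperBoundary 0 i = 0 :=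
  dif_neg fun ⟨_, hp⟩ => lt_irrefl 0 hp.pos

/-!
The full vertices of `S` form its interior for Hamming balls of radius one. In every dimension the
interior is largest for the initial segments of the simplicial order (by weight, then reverse
lexicographically): replacing both slices of a set in some direction by initial segments does not
shrink the interior, by induction on the dimension, and it lowers the total rank in the order, so
only sets all of whose slices are initial segments remain. Such a set can miss `x` and contain a
later `y` only if `x` and `y` are antipodal, which makes the set or its interior an initial segment.
The second case is settled because the neighbourhood of an initial segment is again one.

For an initial segment of the `(k + 1)`-dimensional cube with parameters `i` and `m`, one of the two
slices along the first coordinate is a Hamming ball. The other slice has parameters `i - 1`, `m` if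
`m < C(k, i)`, and `i`, `m - C(k, i)` otherwise; the resulting recursion for the number of full
vertices is the one satisfied by the upper boundary.
-/

section InitialSegment

variable {α β : Type*} [LinearOrder β] {f : α → β} {S T : Finset α}

/-- `S` is an initial segment of the order that a key function `f` induces on its domain. -/
def IsInitialSegment (f : α → β) (S : Finset α) : Prop :=
  ∀ ⦃y⦄, y ∈ S → ∀ ⦃x⦄, f x ≤ f y → x ∈ S

theorem exists_lt_of_not_isInitialSegment (hf : Function.Injective f)
    (h : ¬IsInitialSegment f S) : ∃ x ∉ S, ∃ y ∈ S, f x < f y := by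
  simp only [IsInitialSegment, not_forall] at h
  obtain ⟨y, hy, x, hxy, hx⟩ := h
  exact ⟨x, hx, y, hy, hxy.lt_of_ne fun heq => hx (hf heq ▸ hy)⟩

namespace IsInitialSegment

theorem total (hS : IsInitialSegment f S) (hT : IsInitialSegment f T) : S ⊆ T ∨ T ⊆ S := by
  by_contra! h
  obtain ⟨x, hxS, hxT⟩ := not_subset.1 h.1
  obtain ⟨y, hyT, hyS⟩ := not_subset.1 h.2
  rcases le_total (f x) (f y) with hxy | hyx
  · exact hxT (hT hyT hxy)
  · exact hyS (hS hxS hyx)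

theorem subset_of_card_le (hS : IsInitialSegment f S) (hT : IsInitialSegment f T)
    (h : #S ≤ #T) : S ⊆ T :=
  (hS.total hT).elim id fun h' => (eq_of_subset_of_card_le h' h).ge

theorem eq_of_card_eq (hS : IsInitialSegment f S) (hT : IsInitialSegment f T)
    (h : #S = #T) : S = T :=
  eq_of_subset_of_card_le (hS.subset_of_card_le hT h.le) h.ge

theorem inter [DecidableEq α] (hS : IsInitialSegment f S) (hT : IsInitialSegment f T) :
    IsInitialSegment f (S ∩ T) := fun _ hy _ hxy =>
  mem_inter.2 ⟨hS (mem_inter.1 hy).1 hxy, hT (mem_inter.1 hy).2 hxy⟩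

theorem card_inter [DecidableEq α] (hS : IsInitialSegment f S) (hT : IsInitialSegment f T) :
    #(S ∩ T) = min #S #T := by
  rcases le_total #S #T with h | h
  · rw [inter_eq_left.2 (hS.subset_of_card_le hT h), min_eq_left h]
  · rw [inter_eq_right.2 (hT.subset_of_card_le hS h), min_eq_right h]

theorem sum_lt_sum (hS : IsInitialSegment f S) (hcard : #S = #T) (hne : S ≠ T)
    {g : α → ℕ} (hg : ∀ x y, f x < f y → g x < g y) : ∑ x ∈ S, g x < ∑ x ∈ T, g x := by
  classical
  rw [← sum_sdiff_lt_sum_sdiff]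
  have hST : (S \ T).Nonempty :=
    sdiff_nonempty.2 fun h => hne (eq_of_subset_of_card_le h hcard.ge)
  obtain ⟨m, hm, hmax⟩ := exists_max_image (S \ T) g hST
  rw [mem_sdiff] at hm
  have hlt : ∀ y ∈ T \ S, g m + 1 ≤ g y := fun y hy =>
    hg m y (not_le.1 fun h => (mem_sdiff.1 hy).2 (hS hm.1 h))
  calc ∑ x ∈ S \ T, g x ≤ #(S \ T) * g m := by simpa using sum_le_card_nsmul _ _ _ hmax
    _ < #(S \ T) * (g m + 1) := Nat.mul_lt_mul_of_pos_left (Nat.lt_succ_self _) hST.card_pos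
    _ = #(T \ S) * (g m + 1) := by rw [card_sdiff_comm hcard]
    _ ≤ ∑ x ∈ T \ S, g x := by simpa using card_nsmul_le_sum _ _ _ hlt

end IsInitialSegment

variable [Fintype α]

/-- The position of `x`, counted from `0`, in the order that `f` induces on its domain. -/
def keyRank (f : α → β) (x : α) : ℕ := #{z | f z < f x}

theorem keyRank_le_keyRank {x y : α} (h : f x ≤ f y) : keyRank f x ≤ keyRank f y :=
  card_le_card <| monotone_filter_right _ fun _ _ hz => lt_of_lt_of_le hz h

theorem keyRank_lt_keyRank {x y : α} (h : f x < f y) : keyRank f x < keyRank f y :=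
  card_lt_card <| (ssubset_iff_of_subset <| monotone_filter_right _ fun _ _ hz =>
    lt_trans hz h).2 ⟨x, by simpa using h, by simp⟩

theorem keyRank_lt_card (f : α → β) (x : α) : keyRank f x < Fintype.card α :=
  card_lt_univ_of_notMem (x := x) (by simp)

theorem keyRank_injective (hf : Function.Injective f) : Function.Injective (keyRank f) := by
  intro x y h
  rcases lt_trichotomy (f x) (f y) with hxy | hxy | hxy
  · exact absurd h (keyRank_lt_keyRank hxy).ne
  · exact hf hxy
  · exact absurd h (keyRank_lt_keyRank hxy).ne'

/-- The first `n` elements in the order that `f` induces on its domain (all of them if there are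
fewer than `n`). -/
def initialSegment (f : α → β) (n : ℕ) : Finset α := {x | keyRank f x < n}

theorem isInitialSegment_initialSegment (f : α → β) (n : ℕ) :
    IsInitialSegment f (initialSegment f n) := fun y hy x hxy => by
  simp only [initialSegment, mem_filter_univ] at hy ⊢
  exact (keyRank_le_keyRank hxy).trans_lt hy

theorem card_initialSegment (hf : Function.Injective f) {n : ℕ} (hn : n ≤ Fintype.card α) :
    #(initialSegment f n) = n := by
  have hrank : univ.image (keyRank f) = range (Fintype.card α) := by
    refine eq_of_subset_of_card_le (fun r hr => ?_) ?_
    · obtain ⟨x, -, rfl⟩ := mem_image.1 hr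
      exact mem_range.2 (keyRank_lt_card f x)
    · rw [card_image_of_injective _ (keyRank_injective hf), card_range, card_univ]
  calc #(initialSegment f n) = #((univ.image (keyRank f)).filter (· < n)) := by
        rw [filter_image, card_image_of_injective _ (keyRank_injective hf), initialSegment]
    _ = #(range n) := by
        rw [hrank]
        congr 1
        ext r
        simp only [mem_filter, mem_range]
        omega
    _ = n := card_range n

end InitialSegment

section SimplicialOrder

variable {k : ℕ} {x y : Fin k → Bool}

/-- The number of ones of a binary string. -/
def weight (x : Fin k → Bool) : ℕ := ∑ i, (x i).toNat

/-- The neighbour of `x` in the hypercube along direction `i`. -/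
def flipBit (i : Fin k) (x : Fin k → Bool) : Fin k → Bool := Function.update x i (!x i)

/-- The key of the simplicial order on binary strings: strings are compared by weight, and among
strings of equal weight the lexicographically larger one comes first. -/
def simplicialKey (x : Fin k → Bool) : ℕ ×ₗ (Lex (Fin k → Bool))ᵒᵈ :=
  toLex (weight x, OrderDual.toDual (toLex x))

theorem flipBit_self (i : Fin k) (x : Fin k → Bool) : flipBit i x i = !x i := by simp [flipBit]

theorem flipBit_of_ne {i j : Fin k} (h : j ≠ i) (x : Fin k → Bool) : flipBit i x j = x j := by
  simp [flipBit, h]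

theorem flipBit_ne (i : Fin k) (x : Fin k → Bool) : flipBit i x ≠ x := fun h => by
  simpa [flipBit_self] using congrFun h i

theorem flipBit_injective (x : Fin k → Bool) : Function.Injective fun i => flipBit i x := by
  intro i j h
  by_contra hij
  simpa [flipBit_self, flipBit_of_ne hij] using congrFun h i

theorem lt_flipBit {i : Fin k} (h : x i = false) : x < flipBit i x := by
  simp [flipBit, h]

theorem flipBit_lt {i : Fin k} (h : x i = true) : flipBit i x < x := by
  simp [flipBit, h]

theorem hammingDist_eq_one_iff : hammingDist x y = 1 ↔ ∃ i, y = flipBit i x := by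
  rw [hammingDist, card_eq_one]
  refine exists_congr fun i => ?_
  simp only [Finset.ext_iff, mem_filter_univ, mem_singleton, funext_iff]
  refine forall_congr' fun j => ?_
  rcases eq_or_ne j i with rfl | hj
  · simp [flipBit_self, eq_comm, Bool.eq_not]
  · simp [flipBit_of_ne hj, hj, eq_comm]

theorem hammingDist_le_one_iff : hammingDist x y ≤ 1 ↔ y = x ∨ ∃ i, y = flipBit i x := by
  rw [Nat.le_one_iff_eq_zero_or_eq_one, hammingDist_eq_zero, hammingDist_eq_one_iff, eq_comm]

theorem hammingDist_compl (x y : Fin k → Bool) : hammingDist xᶜ yᶜ = hammingDist x y :=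
  hammingDist_comp (fun _ => not) fun _ => Bool.not_injective

theorem weight_flipBit {i : Fin k} (h : x i = false) :
    weight (flipBit i x) = weight x + 1 := by
  have hrest : ∑ j ∈ univ.erase i, (flipBit i x j).toNat = ∑ j ∈ univ.erase i, (x j).toNat :=
    sum_congr rfl fun j hj => by rw [flipBit_of_ne (ne_of_mem_erase hj)]
  rw [weight, weight, ← sum_erase_add _ _ (mem_univ i), hrest,
    ← sum_erase_add univ (fun j => (x j).toNat) (mem_univ i), flipBit_self, h]
  simp

theorem weight_strictMono : StrictMono (weight : (Fin k → Bool) → ℕ) := by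
  intro x y h
  obtain ⟨hle, i, hi⟩ := Pi.lt_def.1 h
  refine sum_lt_sum (fun j _ => Bool.toNat_le_toNat (hle j)) ⟨i, mem_univ i, ?_⟩
  simp [(Bool.lt_iff.1 hi).1, (Bool.lt_iff.1 hi).2]

theorem weight_compl_add_weight (x : Fin k → Bool) : weight xᶜ + weight x = k := by
  have hbit : ∀ b : Bool, (!b).toNat + b.toNat = 1 := by decide
  simp [weight, ← sum_add_distrib, hbit]

theorem exists_eq_false_of_ne_top (h : x ≠ ⊤) : ∃ i, x i = false := by
  simpa using Function.ne_iff.1 h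

theorem exists_eq_false_of_weight_lt (h : weight x < k) : ∃ i, x i = false := by
  by_contra! hx
  simp [weight, hx] at h

theorem simplicialKey_lt_iff : simplicialKey x < simplicialKey y ↔
    weight x < weight y ∨ weight x = weight y ∧
      ∃ d, (∀ j < d, x j = y j) ∧ x d = true ∧ y d = false := by
  rw [simplicialKey, simplicialKey, Prod.Lex.toLex_lt_toLex]
  refine or_congr_right (and_congr_right fun _ => ?_)
  change (∃ d, (∀ j, j < d → y j = x j) ∧ y d < x d) ↔ _
  simp only [Bool.lt_iff, eq_comm, and_comm]

theorem simplicialKey_lt_of_weight_lt (h : weight x < weight y) :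
    simplicialKey x < simplicialKey y :=
  simplicialKey_lt_iff.2 (Or.inl h)

theorem simplicialKey_injective :
    Function.Injective (simplicialKey : (Fin k → Bool) → _) := fun x y h => by
  simpa [simplicialKey] using congrArg (fun p => (ofLex p).2) h

theorem simplicialKey_strictMono : StrictMono (simplicialKey : (Fin k → Bool) → _) :=
  fun _ _ h => simplicialKey_lt_of_weight_lt (weight_strictMono h)

theorem weight_le_of_simplicialKey_le (h : simplicialKey x ≤ simplicialKey y) :
    weight x ≤ weight y :=
  not_lt.1 fun hlt => h.not_gt (simplicialKey_lt_of_weight_lt hlt)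

theorem simplicialKey_compl_lt (h : simplicialKey x < simplicialKey y) :
    simplicialKey yᶜ < simplicialKey xᶜ := by
  have hx := weight_compl_add_weight x
  have hy := weight_compl_add_weight y
  rw [simplicialKey_lt_iff] at h ⊢
  refine h.imp (fun h => by omega) fun ⟨hw, d, hd, hxd, hyd⟩ =>
    ⟨by rw [hw] at hx; omega, d, fun j hj => ?_, ?_, ?_⟩
  · simp [hd j hj]
  · simp [hyd]
  · simp [hxd]

theorem simplicialKey_compl_le (h : simplicialKey x ≤ simplicialKey y) :
    simplicialKey yᶜ ≤ simplicialKey xᶜ := by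
  rcases h.lt_or_eq with h | h
  · exact (simplicialKey_compl_lt h).le
  · rw [simplicialKey_injective h]

theorem exists_simplicialKey_flipBit_le (hxy : simplicialKey x < simplicialKey y) (hy : y ≠ ⊤)
    {e : Fin k} (he : x e = false) :
    ∃ f, simplicialKey (flipBit e x) ≤ simplicialKey (flipBit f y) := by
  rcases simplicialKey_lt_iff.1 hxy with hw | ⟨hw, d, hd, hxd, hyd⟩
  · obtain ⟨f, hf⟩ := exists_eq_false_of_ne_top hy
    refine ⟨f, (simplicialKey_lt_of_weight_lt ?_).le⟩
    rw [weight_flipBit he, weight_flipBit hf]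
    omega
  have hed : e ≠ d := by
    rintro rfl
    simp [hxd] at he
  have key_le : ∀ f, y f = false → d ≠ f → (∀ j < d, flipBit e x j = flipBit f y j) →
      simplicialKey (flipBit e x) ≤ simplicialKey (flipBit f y) := fun f hf hdf hagree =>
    (simplicialKey_lt_iff.2 (Or.inr ⟨by rw [weight_flipBit he, weight_flipBit hf, hw], d, hagree,
      by rwa [flipBit_of_ne hed.symm], by rwa [flipBit_of_ne hdf]⟩)).le
  cases hye : y e with
  | false =>
    refine ⟨e, key_le e hye hed.symm fun j hj => ?_⟩
    rcases eq_or_ne j e with rfl | hje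
    · rw [flipBit_self, flipBit_self, he, hye]
    · rw [flipBit_of_ne hje, flipBit_of_ne hje, hd j hj]
  | true =>
    have hde : d < e := lt_of_le_of_ne (not_lt.1 fun h => by simp [← hd e h, he] at hye) hed.symm
    by_cases hzero : ∃ f, d < f ∧ y f = false
    · obtain ⟨f, hdf, hf⟩ := hzero
      refine ⟨f, key_le f hf hdf.ne fun j hj => ?_⟩
      rw [flipBit_of_ne (hj.trans hde).ne, flipBit_of_ne (hj.trans hdf).ne, hd j hj]
    -- behind `d` the string `y` consists of ones, so flipping its bit `d` dominates `x`
    · push Not at hzero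
      refine ⟨d, simplicialKey_strictMono.monotone fun j => ?_⟩
      rcases lt_trichotomy j d with hj | rfl | hj
      · rw [flipBit_of_ne (hj.trans hde).ne, flipBit_of_ne hj.ne, hd j hj]
      · simp [flipBit_self, hyd, Bool.le_true]
      · simp [flipBit_of_ne hj.ne', hzero j hj, Bool.le_true]

theorem exists_simplicialKey_ge_of_hammingDist_le_one {x' : Fin k → Bool}
    (hxy : simplicialKey x ≤ simplicialKey y) (hx : hammingDist x x' ≤ 1) :
    ∃ y', hammingDist y y' ≤ 1 ∧ simplicialKey x' ≤ simplicialKey y' := by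
  have near_self : hammingDist y y ≤ 1 := by simp
  rcases hxy.eq_or_lt with heq | hlt
  · exact ⟨x', simplicialKey_injective heq ▸ hx, le_rfl⟩
  rcases hammingDist_le_one_iff.1 hx with rfl | ⟨e, rfl⟩
  · exact ⟨y, near_self, hxy⟩
  cases he : x e with
  | true => exact ⟨y, near_self, (simplicialKey_strictMono (flipBit_lt he)).le.trans hxy⟩
  | false =>
    rcases eq_or_ne y ⊤ with rfl | hy
    · exact ⟨⊤, near_self, simplicialKey_strictMono.monotone le_top⟩
    · obtain ⟨f, hf⟩ := exists_simplicialKey_flipBit_le hlt hy he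
      exact ⟨flipBit f y, hammingDist_le_one_iff.2 (Or.inr ⟨f, rfl⟩), hf⟩

theorem exists_simplicialKey_le_of_hammingDist_le_one {y' : Fin k → Bool}
    (hxy : simplicialKey x ≤ simplicialKey y) (hy : hammingDist y y' ≤ 1) :
    ∃ x', hammingDist x x' ≤ 1 ∧ simplicialKey x' ≤ simplicialKey y' := by
  obtain ⟨z, hz, hle⟩ := exists_simplicialKey_ge_of_hammingDist_le_one
    (simplicialKey_compl_le hxy) ((hammingDist_compl y y').trans_le hy)
  refine ⟨zᶜ, ?_, ?_⟩
  · rwa [← hammingDist_compl, compl_compl]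
  · simpa using simplicialKey_compl_le hle

end SimplicialOrder

section CubeInterior

variable {k : ℕ} {S T : Finset (Fin k → Bool)}

/-- The set of strings whose closed unit Hamming ball is contained in `S`: the full vertices
of `S`. -/
def cubeInterior (S : Finset (Fin k → Bool)) : Finset (Fin k → Bool) :=
  {x | ∀ y, hammingDist x y ≤ 1 → y ∈ S}

/-- The set of strings at Hamming distance at most `1` from `S`. -/
def cubeNeighborhood (S : Finset (Fin k → Bool)) : Finset (Fin k → Bool) :=
  {y | ∃ x ∈ S, hammingDist x y ≤ 1}

theorem mem_cubeInterior {x : Fin k → Bool} :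
    x ∈ cubeInterior S ↔ ∀ y, hammingDist x y ≤ 1 → y ∈ S :=
  mem_filter_univ x

theorem mem_cubeNeighborhood {y : Fin k → Bool} :
    y ∈ cubeNeighborhood S ↔ ∃ x ∈ S, hammingDist x y ≤ 1 :=
  mem_filter_univ y

theorem mem_cubeInterior_iff_flipBit {x : Fin k → Bool} :
    x ∈ cubeInterior S ↔ x ∈ S ∧ ∀ i, flipBit i x ∈ S := by
  simp [mem_cubeInterior, hammingDist_le_one_iff, or_imp, forall_and]

theorem cubeInterior_subset (S : Finset (Fin k → Bool)) : cubeInterior S ⊆ S := fun _ hx =>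
  (mem_cubeInterior_iff_flipBit.1 hx).1

theorem cubeInterior_mono (h : S ⊆ T) : cubeInterior S ⊆ cubeInterior T := fun _ hx =>
  mem_cubeInterior.2 fun y hy => h (mem_cubeInterior.1 hx y hy)

theorem cubeInterior_univ : cubeInterior (univ : Finset (Fin k → Bool)) = univ := by
  simp [cubeInterior]

theorem cubeNeighborhood_subset_iff : cubeNeighborhood S ⊆ T ↔ S ⊆ cubeInterior T := by
  simp only [subset_iff, mem_cubeNeighborhood, mem_cubeInterior]
  grind

theorem IsInitialSegment.interior (hS : IsInitialSegment simplicialKey S) :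
    IsInitialSegment simplicialKey (cubeInterior S) := fun _ hy _ hxy =>
  mem_cubeInterior.2 fun _ hx' =>
    have ⟨y', hy', hle⟩ := exists_simplicialKey_ge_of_hammingDist_le_one hxy hx'
    hS (mem_cubeInterior.1 hy y' hy') hle

theorem IsInitialSegment.neighborhood (hS : IsInitialSegment simplicialKey S) :
    IsInitialSegment simplicialKey (cubeNeighborhood S) := fun y' hy' x' hle => by
  obtain ⟨y, hy, hyy'⟩ := mem_cubeNeighborhood.1 hy'
  obtain ⟨x, hx, hxy⟩ := exists_simplicialKey_le_of_hammingDist_le_one hle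
    ((hammingDist_comm y' y).trans_le hyy')
  exact mem_cubeNeighborhood.2 ⟨x, hS hy hxy, (hammingDist_comm x x').trans_le hx⟩

theorem hypercube_isRegularOfDegree (k : ℕ) : (hypercube k).IsRegularOfDegree k := fun x => by
  have hnbr : (hypercube k).neighborFinset x = univ.image fun i => flipBit i x := by
    ext y
    simp only [SimpleGraph.mem_neighborFinset, mem_image, mem_univ, true_and]
    exact hammingDist_eq_one_iff.trans (exists_congr fun _ => eq_comm)
  rw [← SimpleGraph.card_neighborFinset_eq_degree, hnbr,
    card_image_of_injective _ (flipBit_injective x), card_univ, Fintype.card_fin]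

theorem degree_induce_eq_degree_iff {V : Type*} {G : SimpleGraph V} {s : Set V} {v : s}
    [Fintype (G.neighborSet v)] [Fintype ((G.induce s).neighborSet v)] :
    (G.induce s).degree v = G.degree v ↔ G.neighborSet v ⊆ s := by
  have hsub : ((G.induce s).neighborFinset v).map (.subtype (· ∈ s)) ⊆ G.neighborFinset v := by
    simp +contextual [subset_iff]
  rw [← SimpleGraph.card_neighborFinset_eq_degree, ← SimpleGraph.card_neighborFinset_eq_degree,
    ← card_map (.subtype (· ∈ s))]
  calc _ ↔ ((G.induce s).neighborFinset v).map (.subtype (· ∈ s)) = G.neighborFinset v :=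
        ⟨fun h => eq_of_subset_of_card_le hsub h.ge, congrArg card⟩
    _ ↔ _ := by simp [Finset.ext_iff, Set.subset_def]

theorem fullCount_eq_card_cubeInterior (S : Finset (Fin k → Bool)) :
    fullCount k S = #(cubeInterior S) := by
  have hfull : ∀ x : (S : Set (Fin k → Bool)),
      ((hypercube k).induce (S : Set (Fin k → Bool))).degree x = k ↔ x.1 ∈ cubeInterior S := by
    intro x
    conv_lhs => rhs; rw [← hypercube_isRegularOfDegree k x]
    rw [degree_induce_eq_degree_iff, mem_cubeInterior]
    refine forall_congr' fun y => ?_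
    rw [Nat.le_one_iff_eq_zero_or_eq_one, hammingDist_eq_zero, or_imp]
    exact (and_iff_right fun h => h ▸ x.2).symm
  simp only [fullCount, hfull]
  rw [← card_map (.subtype _)]
  congr 1
  ext x
  simpa using fun h => cubeInterior_subset S h

end CubeInterior

section Slices

variable {k : ℕ} {S T : Finset (Fin (k + 1) → Bool)}

/-- The binary string obtained from `x` by inserting the bit `b` at position `i`. -/
abbrev insertBit (i : Fin (k + 1)) (b : Bool) (x : Fin k → Bool) : Fin (k + 1) → Bool :=
  i.insertNth b x

/-- The slice of `S` on which the bit `i` equals `b`, as a set of strings with that bit deleted. -/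
def cubeSlice (i : Fin (k + 1)) (b : Bool) (S : Finset (Fin (k + 1) → Bool)) :
    Finset (Fin k → Bool) :=
  {x | insertBit i b x ∈ S}

/-- The set whose slices in direction `i` are `C false` and `C true`. -/
def cubeGlue (i : Fin (k + 1)) (C : Bool → Finset (Fin k → Bool)) :
    Finset (Fin (k + 1) → Bool) :=
  {x | i.removeNth x ∈ C (x i)}

theorem mem_cubeSlice {i : Fin (k + 1)} {b : Bool} {x : Fin k → Bool} :
    x ∈ cubeSlice i b S ↔ insertBit i b x ∈ S :=
  mem_filter_univ x

theorem mem_cubeGlue {i : Fin (k + 1)} {C : Bool → Finset (Fin k → Bool)}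
    {x : Fin (k + 1) → Bool} : x ∈ cubeGlue i C ↔ i.removeNth x ∈ C (x i) :=
  mem_filter_univ x

theorem cubeSlice_mono (i : Fin (k + 1)) (b : Bool) (h : S ⊆ T) :
    cubeSlice i b S ⊆ cubeSlice i b T := fun _ hx =>
  mem_cubeSlice.2 (h (mem_cubeSlice.1 hx))

theorem cubeSlice_glue (i : Fin (k + 1)) (b : Bool) (C : Bool → Finset (Fin k → Bool)) :
    cubeSlice i b (cubeGlue i C) = C b := by
  ext x
  simp [mem_cubeSlice, mem_cubeGlue]

theorem forall_insertBit_iff (i : Fin (k + 1)) {p : (Fin (k + 1) → Bool) → Prop} :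
    (∀ x, p x) ↔ ∀ b z, p (insertBit i b z) :=
  ⟨fun h _ _ => h _, fun h x => Fin.insertNth_self_removeNth i x ▸ h (x i) (i.removeNth x)⟩

theorem sum_eq_sum_cubeSlice {M : Type*} [AddCommMonoid M] (i : Fin (k + 1))
    (S : Finset (Fin (k + 1) → Bool)) (g : (Fin (k + 1) → Bool) → M) :
    ∑ x ∈ S, g x = ∑ b, ∑ z ∈ cubeSlice i b S, g (insertBit i b z) := by
  calc ∑ x ∈ S, g x = ∑ x, if x ∈ S then g x else 0 := by rw [sum_ite_mem, univ_inter]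
    _ = ∑ p : Bool × (Fin k → Bool),
          if insertBit i p.1 p.2 ∈ S then g (insertBit i p.1 p.2) else 0 :=
        ((Fin.insertNthEquiv (fun _ => Bool) i).sum_comp _).symm
    _ = ∑ b, ∑ z ∈ cubeSlice i b S, g (insertBit i b z) := by
        simp only [Fintype.sum_prod_type, cubeSlice, sum_filter]

theorem card_eq_add_card_cubeSlice (i : Fin (k + 1)) (S : Finset (Fin (k + 1) → Bool)) :
    #S = #(cubeSlice i true S) + #(cubeSlice i false S) := by
  rw [card_eq_sum_ones, sum_eq_sum_cubeSlice i]
  simp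

theorem hammingDist_insertBit (i : Fin (k + 1)) (b c : Bool) (x y : Fin k → Bool) :
    hammingDist (insertBit i b x) (insertBit i c y) =
      (if b = c then 0 else 1) + hammingDist x y := by
  simp [hammingDist, card_filter, Fin.sum_univ_succAbove _ i]

theorem cubeSlice_cubeInterior (i : Fin (k + 1)) (b : Bool) (S : Finset (Fin (k + 1) → Bool)) :
    cubeSlice i b (cubeInterior S) = cubeInterior (cubeSlice i b S) ∩ cubeSlice i (!b) S := by
  ext x
  rw [mem_inter, mem_cubeSlice, mem_cubeInterior, mem_cubeInterior, forall_insertBit_iff i]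
  cases b <;> simp [hammingDist_insertBit, mem_cubeSlice, and_comm]

theorem card_cubeInterior_eq_add (i : Fin (k + 1)) (S : Finset (Fin (k + 1) → Bool)) :
    #(cubeInterior S) = #(cubeInterior (cubeSlice i true S) ∩ cubeSlice i false S) +
      #(cubeInterior (cubeSlice i false S) ∩ cubeSlice i true S) := by
  rw [card_eq_add_card_cubeSlice i, cubeSlice_cubeInterior, cubeSlice_cubeInterior,
    Bool.not_true, Bool.not_false]

theorem weight_insertBit (i : Fin (k + 1)) (b : Bool) (x : Fin k → Bool) :
    weight (insertBit i b x) = b.toNat + weight x := by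
  simp [weight, Fin.sum_univ_succAbove _ i]

theorem simplicialKey_insertBit_lt_of_lt (i : Fin (k + 1)) (b : Bool) {x y : Fin k → Bool}
    (h : simplicialKey x < simplicialKey y) :
    simplicialKey (insertBit i b x) < simplicialKey (insertBit i b y) := by
  rw [simplicialKey_lt_iff] at h ⊢
  rw [weight_insertBit, weight_insertBit]
  refine h.imp (fun h => by omega) fun ⟨hw, d, hd, hx, hy⟩ =>
    ⟨by rw [hw], i.succAbove d, fun j hj => ?_, by simpa using hx, by simpa using hy⟩
  rcases Fin.eq_self_or_eq_succAbove i j with rfl | ⟨j, rfl⟩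
  · simp
  · simpa using hd j ((Fin.strictMono_succAbove i).lt_iff_lt.1 hj)

theorem simplicialKey_insertBit_le_iff (i : Fin (k + 1)) (b : Bool) {x y : Fin k → Bool} :
    simplicialKey (insertBit i b x) ≤ simplicialKey (insertBit i b y) ↔
      simplicialKey x ≤ simplicialKey y := by
  refine ⟨fun h => not_lt.1 fun h' => h.not_gt (simplicialKey_insertBit_lt_of_lt i b h'),
    fun h => ?_⟩
  rcases h.lt_or_eq with h | h
  · exact (simplicialKey_insertBit_lt_of_lt i b h).le
  · rw [simplicialKey_injective h]

theorem IsInitialSegment.slice (hS : IsInitialSegment simplicialKey S) (i : Fin (k + 1))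
    (b : Bool) : IsInitialSegment simplicialKey (cubeSlice i b S) := fun _ hy _ hxy =>
  mem_cubeSlice.2 (hS (mem_cubeSlice.1 hy) ((simplicialKey_insertBit_le_iff i b).2 hxy))

end Slices

section Harper

variable {k : ℕ}

section Compressed

variable {S : Finset (Fin (k + 1) → Bool)} {x y : Fin (k + 1) → Bool}

/-- A set of binary strings is compressed if all its slices are initial segments of the
simplicial order. -/
def IsCompressed (S : Finset (Fin (k + 1) → Bool)) : Prop :=
  ∀ i b, IsInitialSegment simplicialKey (cubeSlice i b S)

theorem IsCompressed.interior (hS : IsCompressed S) : IsCompressed (cubeInterior S) :=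
  fun i b => by
    rw [cubeSlice_cubeInterior]
    exact (hS i b).interior.inter (hS i !b)

theorem IsCompressed.eq_compl (hS : IsCompressed S) (hx : x ∉ S) (hy : y ∈ S)
    (hxy : simplicialKey x < simplicialKey y) : y = xᶜ := by
  funext i
  by_contra hne
  have hi : y i = x i := by simpa using hne
  have hxi : insertBit i (x i) (i.removeNth x) = x := Fin.insertNth_self_removeNth i x
  have hyi : insertBit i (x i) (i.removeNth y) = y := hi ▸ Fin.insertNth_self_removeNth i y
  have hle : simplicialKey (i.removeNth x) ≤ simplicialKey (i.removeNth y) := by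
    rw [← simplicialKey_insertBit_le_iff i (x i), hxi, hyi]
    exact hxy.le
  exact hx (hxi ▸ mem_cubeSlice.1 (hS i (x i) (mem_cubeSlice.2 (hyi.symm ▸ hy)) hle))

theorem IsCompressed.notMem_cubeInterior (hS : IsCompressed S) (hx : x ∉ S)
    (hxy : simplicialKey x < simplicialKey y) : y ∉ cubeInterior S := by
  -- if `y = xᶜ` is full, then all its neighbours precede `x`, so `y` is all ones and `x` all zeros
  intro hy
  obtain ⟨hyS, hflip⟩ := mem_cubeInterior_iff_flipBit.1 hy
  have hlt : ∀ i, simplicialKey (flipBit i y) < simplicialKey x := by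
    refine fun i => lt_of_not_ge fun hle => flipBit_ne i y ?_
    have hne : simplicialKey x ≠ simplicialKey (flipBit i y) := fun h =>
      hx (simplicialKey_injective h ▸ hflip i)
    rw [hS.eq_compl hx (hflip i) (hle.lt_of_ne hne), hS.eq_compl hx hyS hxy]
  have htop : y = ⊤ := by
    by_contra hne
    obtain ⟨i, hi⟩ := exists_eq_false_of_ne_top hne
    exact lt_asymm ((hlt i).trans hxy) (simplicialKey_strictMono (lt_flipBit hi))
  have hbot : x = ⊥ := by
    rw [← compl_compl x, ← hS.eq_compl hx hyS hxy, htop, compl_top]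
  exact (hlt 0).not_ge (simplicialKey_strictMono.monotone (hbot ▸ bot_le))

theorem IsCompressed.isInitialSegment_or_cubeInterior (hS : IsCompressed S) :
    IsInitialSegment simplicialKey S ∨ IsInitialSegment simplicialKey (cubeInterior S) := by
  by_contra! h
  obtain ⟨x, hx, y, hy, hxy⟩ := exists_lt_of_not_isInitialSegment simplicialKey_injective h.1
  obtain ⟨x', hx', y', hy', hxy'⟩ := exists_lt_of_not_isInitialSegment simplicialKey_injective h.2
  rcases lt_trichotomy (simplicialKey x) (simplicialKey y') with hlt | heq | hgt
  · exact hS.notMem_cubeInterior hx hlt hy'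
  · exact hx (simplicialKey_injective heq ▸ cubeInterior_subset S hy')
  · have hcompl := simplicialKey_compl_lt (hxy'.trans hgt)
    rw [← hS.eq_compl hx hy hxy, ← hS.interior.eq_compl hx' hy' hxy'] at hcompl
    exact lt_asymm hxy (hcompl.trans hgt)

end Compressed

theorem IsInitialSegment.card_cubeInterior_le_of_cubeInterior {C S : Finset (Fin k → Bool)}
    (hC : IsInitialSegment simplicialKey C) (hcard : #S ≤ #C)
    (hS : IsInitialSegment simplicialKey (cubeInterior S)) :
    #(cubeInterior S) ≤ #(cubeInterior C) :=
  have hle : #(cubeNeighborhood (cubeInterior S)) ≤ #C :=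
    (card_le_card (cubeNeighborhood_subset_iff.2 subset_rfl)).trans hcard
  card_le_card (cubeNeighborhood_subset_iff.1 (hS.neighborhood.subset_of_card_le hC hle))

/-- The compression of `S` in direction `i`: both slices are replaced by initial segments of the
simplicial order. -/
noncomputable def compress (i : Fin (k + 1)) (S : Finset (Fin (k + 1) → Bool)) :
    Finset (Fin (k + 1) → Bool) :=
  cubeGlue i fun b => initialSegment simplicialKey #(cubeSlice i b S)

theorem isInitialSegment_cubeSlice_compress (i : Fin (k + 1)) (b : Bool)
    (S : Finset (Fin (k + 1) → Bool)) :
    IsInitialSegment simplicialKey (cubeSlice i b (compress i S)) := by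
  rw [compress, cubeSlice_glue]
  exact isInitialSegment_initialSegment _ _

theorem card_cubeSlice_compress (i : Fin (k + 1)) (b : Bool) (S : Finset (Fin (k + 1) → Bool)) :
    #(cubeSlice i b (compress i S)) = #(cubeSlice i b S) := by
  rw [compress, cubeSlice_glue, card_initialSegment simplicialKey_injective (card_le_univ _)]

theorem card_compress (i : Fin (k + 1)) (S : Finset (Fin (k + 1) → Bool)) :
    #(compress i S) = #S := by
  simp only [card_eq_add_card_cubeSlice i, card_cubeSlice_compress]

theorem sum_keyRank_compress_lt {i : Fin (k + 1)} {b : Bool} {S : Finset (Fin (k + 1) → Bool)}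
    (h : ¬IsInitialSegment simplicialKey (cubeSlice i b S)) :
    ∑ x ∈ compress i S, keyRank simplicialKey x < ∑ x ∈ S, keyRank simplicialKey x := by
  have hslice : ∀ c, cubeSlice i c (compress i S) ≠ cubeSlice i c S →
      ∑ z ∈ cubeSlice i c (compress i S), keyRank simplicialKey (insertBit i c z) <
        ∑ z ∈ cubeSlice i c S, keyRank simplicialKey (insertBit i c z) := fun c hne =>
    (isInitialSegment_cubeSlice_compress i c S).sum_lt_sum (card_cubeSlice_compress i c S) hne
      fun _ _ hlt => keyRank_lt_keyRank (simplicialKey_insertBit_lt_of_lt i c hlt)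
  rw [sum_eq_sum_cubeSlice i (compress i S), sum_eq_sum_cubeSlice i S]
  refine sum_lt_sum (fun c _ => ?_) ⟨b, mem_univ b, hslice b fun heq =>
    h (heq ▸ isInitialSegment_cubeSlice_compress i b S)⟩
  by_cases hc : cubeSlice i c (compress i S) = cubeSlice i c S
  · rw [hc]
  · exact (hslice c hc).le

theorem card_cubeInterior_le_compress
    (harper : ∀ C S : Finset (Fin k → Bool), IsInitialSegment simplicialKey C → #C = #S →
      #(cubeInterior S) ≤ #(cubeInterior C))
    (i : Fin (k + 1)) (S : Finset (Fin (k + 1) → Bool)) :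
    #(cubeInterior S) ≤ #(cubeInterior (compress i S)) := by
  have hslice : ∀ b c, #(cubeInterior (cubeSlice i b S) ∩ cubeSlice i c S) ≤
      #(cubeInterior (cubeSlice i b (compress i S)) ∩ cubeSlice i c (compress i S)) := by
    intro b c
    have hb := isInitialSegment_cubeSlice_compress i b S
    rw [hb.interior.card_inter (isInitialSegment_cubeSlice_compress i c S),
      card_cubeSlice_compress]
    exact le_min
      ((card_le_card inter_subset_left).trans (harper _ _ hb (card_cubeSlice_compress i b S)))
      (card_le_card inter_subset_right)
  rw [card_cubeInterior_eq_add i S, card_cubeInterior_eq_add i (compress i S)]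
  exact add_le_add (hslice true false) (hslice false true)

/-- **Harper's theorem**, for interiors instead of neighbourhoods. -/
theorem IsInitialSegment.card_cubeInterior_le {C S : Finset (Fin k → Bool)}
    (hC : IsInitialSegment simplicialKey C) (hcard : #C = #S) :
    #(cubeInterior S) ≤ #(cubeInterior C) := by
  induction k with
  | zero =>
    have hS : IsInitialSegment simplicialKey S := fun y hy x _ => Subsingleton.elim y x ▸ hy
    rw [hC.eq_of_card_eq hS hcard]
  | succ k ih =>
    induction hr : ∑ x ∈ S, keyRank simplicialKey x using Nat.strong_induction_on
      generalizing S with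
    | _ r ihr =>
    subst hr
    by_cases hS : IsCompressed S
    · rcases hS.isInitialSegment_or_cubeInterior with hS | hS
      · rw [hC.eq_of_card_eq hS hcard]
      · exact hC.card_cubeInterior_le_of_cubeInterior hcard.ge hS
    · simp only [IsCompressed, not_forall] at hS
      obtain ⟨i, b, hib⟩ := hS
      calc #(cubeInterior S) ≤ #(cubeInterior (compress i S)) :=
            card_cubeInterior_le_compress (fun _ _ => ih) i S
        _ ≤ #(cubeInterior C) :=
            ihr _ (sum_keyRank_compress_lt hib) (hcard.trans (card_compress i S).symm) rfl

end Harper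

section HammingBall

variable {k i : ℕ}

theorem sum_range_succ_choose_succ (k i : ℕ) :
    ∑ l ∈ range (i + 1), (k + 1).choose l =
      ∑ l ∈ range (i + 1), k.choose l + ∑ l ∈ range i, k.choose l := by
  rw [sum_range_succ', sum_range_succ' (fun l => k.choose l)]
  simp only [Nat.choose_succ_succ', sum_add_distrib, Nat.choose_zero_right]
  ring

/-- The open Hamming ball of radius `i` about the zero string. -/
def hammingBall (k i : ℕ) : Finset (Fin k → Bool) := {x | weight x < i}

theorem mem_hammingBall {x : Fin k → Bool} : x ∈ hammingBall k i ↔ weight x < i :=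
  mem_filter_univ x

theorem isInitialSegment_hammingBall (k i : ℕ) :
    IsInitialSegment simplicialKey (hammingBall k i) := fun _ hy _ hxy =>
  mem_hammingBall.2 ((weight_le_of_simplicialKey_le hxy).trans_lt (mem_hammingBall.1 hy))

theorem cubeSlice_false_hammingBall (j : Fin (k + 1)) (i : ℕ) :
    cubeSlice j false (hammingBall (k + 1) i) = hammingBall k i := by
  ext x
  simp [mem_cubeSlice, mem_hammingBall, weight_insertBit]

theorem cubeSlice_true_hammingBall (j : Fin (k + 1)) (i : ℕ) :
    cubeSlice j true (hammingBall (k + 1) (i + 1)) = hammingBall k i := by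
  ext x
  simp [mem_cubeSlice, mem_hammingBall, weight_insertBit, add_comm 1]

theorem card_hammingBall (k i : ℕ) : #(hammingBall k i) = ∑ l ∈ range i, k.choose l := by
  induction k generalizing i with
  | zero => cases i <;> simp [hammingBall, weight, sum_range_succ']
  | succ k ih =>
    cases i with
    | zero => simp [hammingBall]
    | succ i =>
      rw [card_eq_add_card_cubeSlice 0, cubeSlice_false_hammingBall, cubeSlice_true_hammingBall,
        ih, ih, sum_range_succ_choose_succ, add_comm]

theorem card_hammingBall_succ (k i : ℕ) :
    #(hammingBall k (i + 1)) = #(hammingBall k i) + k.choose i := by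
  rw [card_hammingBall, card_hammingBall, sum_range_succ]

theorem card_hammingBall_succ_succ (k i : ℕ) :
    #(hammingBall (k + 1) (i + 1)) = #(hammingBall k (i + 1)) + #(hammingBall k i) := by
  simp only [card_hammingBall, sum_range_succ_choose_succ]

theorem two_mul_card_hammingBall (hi : i ≤ k) :
    2 * #(hammingBall k i) = #(hammingBall (k + 1) i) + k.choose (k - i + 1) := by
  cases i with
  | zero => simp [hammingBall]
  | succ i =>
    have hball := card_hammingBall_succ k i
    rw [card_hammingBall_succ_succ, show k - (i + 1) + 1 = k - i by omega,
      Nat.choose_symm (Nat.le_of_succ_le hi)]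
    omega

theorem hammingBall_subset_cubeInterior (k i : ℕ) :
    hammingBall k i ⊆ cubeInterior (hammingBall k (i + 1)) := fun x hx => by
  rw [mem_hammingBall] at hx
  refine mem_cubeInterior_iff_flipBit.2 ⟨mem_hammingBall.2 (hx.trans (Nat.lt_succ_self i)),
    fun j => mem_hammingBall.2 ?_⟩
  cases hj : x j with
  | false => rwa [weight_flipBit hj, Nat.add_lt_add_iff_right]
  | true => exact (weight_strictMono (flipBit_lt hj)).trans (hx.trans (Nat.lt_succ_self i))

theorem cubeInterior_hammingBall (hi : i < k) :
    cubeInterior (hammingBall k (i + 1)) = hammingBall k i := by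
  refine Subset.antisymm (fun x hx => ?_) (hammingBall_subset_cubeInterior k i)
  obtain ⟨hxi, hflip⟩ := mem_cubeInterior_iff_flipBit.1 hx
  rw [mem_hammingBall] at hxi ⊢
  obtain ⟨j, hj⟩ := exists_eq_false_of_weight_lt (by omega : weight x < k)
  have hfl := mem_hammingBall.1 (hflip j)
  rwa [weight_flipBit hj, Nat.add_lt_add_iff_right] at hfl

theorem weight_removeNth_zero_le {x y : Fin (k + 1) → Bool}
    (h : simplicialKey x ≤ simplicialKey y) :
    weight (Fin.removeNth 0 x) ≤ weight (Fin.removeNth 0 y) := by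
  have hweight : ∀ z : Fin (k + 1) → Bool, weight z = (z 0).toNat + weight (Fin.removeNth 0 z) :=
    fun z => Fin.sum_univ_succAbove _ 0
  rcases h.eq_or_lt with heq | hlt
  · rw [simplicialKey_injective heq]
  have hx := hweight x
  have hy := hweight y
  have hy0 := Bool.toNat_le (y 0)
  rcases simplicialKey_lt_iff.1 hlt with hw | ⟨hw, d, hd, hxd, hyd⟩
  · omega
  · have hbit : (y 0).toNat ≤ (x 0).toNat := by
      rcases eq_or_ne d 0 with rfl | hd0
      · simp [hxd, hyd]
      · rw [hd 0 (Fin.pos_iff_ne_zero.2 hd0)]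
    omega

theorem isInitialSegment_cubeGlue_hammingBall (k i : ℕ) :
    IsInitialSegment simplicialKey (cubeGlue 0 fun _ => hammingBall k i) := fun _ hy _ hxy => by
  rw [mem_cubeGlue, mem_hammingBall] at hy ⊢
  exact (weight_removeNth_zero_le hxy).trans_lt hy

theorem card_cubeGlue_hammingBall (k i : ℕ) :
    #(cubeGlue 0 fun _ => hammingBall k i) = 2 * #(hammingBall k i) := by
  rw [card_eq_add_card_cubeSlice 0, cubeSlice_glue, cubeSlice_glue, two_mul]

theorem isHCR_iff {n m : ℕ} :
    IsHCR k n i m ↔ n = #(hammingBall k (i + 1)) + m ∧ m < k.choose (i + 1) := by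
  rw [card_hammingBall, IsHCR]

end HammingBall

section UpperBoundary

variable {c j r : ℕ}

theorem isUBR_choose (hj : 1 ≤ j) (hjc : j ≤ c) : IsUBR (c.choose j) j j fun _ => c :=
  ⟨hj, le_rfl, hjc, fun _ h h' => absurd h h'.not_ge, by simp⟩

theorem IsUBR.cons {p : ℕ} {a : ℕ → ℕ} (ha : IsUBR r j p a) (hr : r < c.choose j) :
    IsUBR (c.choose (j + 1) + r) (j + 1) p (Function.update a (j + 1) c) := by
  have hpj := ha.le_top
  have hne : ∀ {l}, l ≤ j → l ≠ j + 1 := fun h => by omega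
  have htop : a j < c := lt_of_not_ge fun hc =>
    ((Nat.choose_le_choose j hc).trans ha.choose_le).not_gt hr
  refine ⟨ha.one_le, by omega, ?_, fun l hpl hlj => ?_, ?_⟩
  · rw [Function.update_of_ne (hne hpj)]
    exact ha.le_last
  · rcases (Nat.lt_succ_iff.1 hlj).lt_or_eq with hlj | rfl
    · rw [Function.update_of_ne (hne hlj), Function.update_of_ne (hne hlj.le)]
      exact ha.lt_succ l hpl hlj
    · rwa [Function.update_self, Function.update_of_ne (hne le_rfl)]
  · rw [sum_Icc_succ_top (by omega), Function.update_self, add_comm, ha.sum_eq]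
    congr 1
    exact sum_congr rfl fun l hl => by rw [Function.update_of_ne (hne (mem_Icc.1 hl).2)]

theorem upperBoundary_choose_add (hjc : j < c) (hr : r < c.choose j) :
    upperBoundary (c.choose (j + 1) + r) (j + 1) = c.choose (j + 2) + upperBoundary r j := by
  rcases Nat.eq_zero_or_pos r with rfl | hpos
  · rw [add_zero, (isUBR_choose (Nat.succ_pos j) hjc).upperBoundary_eq, upperBoundary_zero]
    simp
  · have hj : 1 ≤ j := Nat.pos_of_ne_zero fun h0 => by
      rw [h0, Nat.choose_zero_right] at hr
      omega
    obtain ⟨p, a, ha⟩ := exists_isUBR hpos hj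
    rw [(ha.cons hr).upperBoundary_eq, ha.upperBoundary_eq,
      sum_Icc_succ_top (ha.le_top.trans j.le_succ), Function.update_self, add_comm]
    congr 1
    refine sum_congr rfl fun l hl => ?_
    rw [Function.update_of_ne (Nat.lt_succ_of_le (mem_Icc.1 hl).2).ne]

theorem upperBoundary_choose_symm_add {k i : ℕ} (hr : r < k.choose (i + 1)) :
    upperBoundary (k.choose i + r) (k - i) =
      k.choose (k - i + 1) + upperBoundary r (k - i - 1) := by
  have hik : i + 1 ≤ k := Nat.choose_ne_zero_iff.1 (Nat.ne_zero_of_lt hr)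
  obtain ⟨j, rfl⟩ := Nat.exists_eq_add_of_le hik
  have hj : i + 1 + j - i = j + 1 := by omega
  rw [Nat.choose_symm_add] at hr
  rw [hj, Nat.add_sub_cancel, Nat.choose_symm_of_eq_add (show i + 1 + j = i + (j + 1) by omega)]
  exact upperBoundary_choose_add (by omega) hr

end UpperBoundary

section InitialSegmentInterior

variable {k i m r : ℕ}

theorem IsHCR.radius_lt {n : ℕ} (h : IsHCR k n i m) : i < k :=
  Nat.choose_ne_zero_iff.1 (Nat.ne_zero_of_lt h.2)

section Slices

variable {C : Finset (Fin (k + 1) → Bool)}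

theorem IsInitialSegment.cubeSlice_true_subset (hC : IsInitialSegment simplicialKey C)
    (j : Fin (k + 1)) : cubeSlice j true C ⊆ cubeSlice j false C := fun x hx => by
  refine mem_cubeSlice.2 (hC (mem_cubeSlice.1 hx) (simplicialKey_strictMono.monotone ?_))
  exact Fin.insertNth_le_iff.2 (by simp)

theorem IsInitialSegment.card_cubeInterior_eq_add_min (hC : IsInitialSegment simplicialKey C)
    (j : Fin (k + 1)) : #(cubeInterior C) = #(cubeInterior (cubeSlice j true C)) +
      min #(cubeInterior (cubeSlice j false C)) #(cubeSlice j true C) := by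
  rw [card_cubeInterior_eq_add j, (hC.slice j false).interior.card_inter (hC.slice j true),
    inter_eq_left.2 ((cubeInterior_subset _).trans (hC.cubeSlice_true_subset j))]

theorem IsHCR.cubeSlice_false_eq_hammingBall (h : IsHCR (k + 1) #C i m)
    (hC : IsInitialSegment simplicialKey C) (hm : m ≤ k.choose i) :
    cubeSlice 0 false C = hammingBall k (i + 1) := by
  have hcard := (isHCR_iff.1 h).1
  rw [card_hammingBall_succ_succ] at hcard
  have hball := card_hammingBall_succ k i
  apply Subset.antisymm
  · rw [← cubeSlice_glue 0 false fun _ => hammingBall k (i + 1)]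
    refine cubeSlice_mono 0 false
      (hC.subset_of_card_le (isInitialSegment_cubeGlue_hammingBall k (i + 1)) ?_)
    rw [card_cubeGlue_hammingBall]
    omega
  · rw [← cubeSlice_false_hammingBall 0]
    refine cubeSlice_mono 0 false
      ((isInitialSegment_hammingBall (k + 1) (i + 1)).subset_of_card_le hC ?_)
    rw [card_hammingBall_succ_succ]
    omega

theorem IsHCR.cubeSlice_true_eq_hammingBall (h : IsHCR (k + 1) #C i m)
    (hC : IsInitialSegment simplicialKey C) (hm : k.choose i ≤ m) :
    cubeSlice 0 true C = hammingBall k (i + 1) := by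
  obtain ⟨hcard, hlt⟩ := isHCR_iff.1 h
  have hballs := card_hammingBall_succ (k + 1) (i + 1)
  rw [card_hammingBall_succ_succ] at hcard
  have hball := card_hammingBall_succ k i
  apply Subset.antisymm
  · rw [← cubeSlice_true_hammingBall 0]
    refine cubeSlice_mono 0 true
      (hC.subset_of_card_le (isInitialSegment_hammingBall (k + 1) (i + 2)) ?_)
    rw [hballs, card_hammingBall_succ_succ]
    omega
  · rw [← cubeSlice_glue 0 true fun _ => hammingBall k (i + 1)]
    refine cubeSlice_mono 0 true
      ((isInitialSegment_cubeGlue_hammingBall k (i + 1)).subset_of_card_le hC ?_)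
    rw [card_cubeGlue_hammingBall]
    omega

theorem IsHCR.card_cubeSlice_true (h : IsHCR (k + 1) #C i m)
    (hC : IsInitialSegment simplicialKey C) (hm : m ≤ k.choose i) :
    #(cubeSlice 0 true C) = #(hammingBall k i) + m := by
  have hcard := (isHCR_iff.1 h).1
  rw [card_eq_add_card_cubeSlice 0, h.cubeSlice_false_eq_hammingBall hC hm,
    card_hammingBall_succ_succ] at hcard
  omega

theorem IsHCR.isHCR_cubeSlice_false (h : IsHCR (k + 1) #C i (k.choose i + r))
    (hC : IsInitialSegment simplicialKey C) : IsHCR k #(cubeSlice 0 false C) i r := by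
  obtain ⟨hcard, hlt⟩ := isHCR_iff.1 h
  have hball := card_hammingBall_succ k i
  rw [card_eq_add_card_cubeSlice 0, card_hammingBall_succ_succ,
    h.cubeSlice_true_eq_hammingBall hC (Nat.le_add_right _ _)] at hcard
  rw [Nat.choose_succ_succ', Nat.add_lt_add_iff_left] at hlt
  exact isHCR_iff.2 ⟨by omega, hlt⟩

theorem IsHCR.card_cubeInterior_of_lt (h : IsHCR (k + 1) #C i m)
    (hC : IsInitialSegment simplicialKey C) (hm : m < k.choose i) :
    #(cubeInterior C) = #(cubeInterior (cubeSlice 0 true C)) + #(hammingBall k i) := by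
  rw [hC.card_cubeInterior_eq_add_min 0, h.cubeSlice_false_eq_hammingBall hC hm.le,
    h.card_cubeSlice_true hC hm.le]
  congr 1
  have hik : i ≤ k := Nat.choose_ne_zero_iff.1 (Nat.ne_zero_of_lt hm)
  rcases hik.lt_or_eq with hik | rfl
  · rw [cubeInterior_hammingBall hik, min_eq_left (Nat.le_add_right _ _)]
  · rw [Nat.choose_self, Nat.lt_one_iff] at hm
    rw [hm, add_zero, min_eq_right (card_le_card (hammingBall_subset_cubeInterior i i))]

end Slices

theorem IsHCR.card_cubeInterior_le {C : Finset (Fin k → Bool)} (h : IsHCR k #C i m)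
    (hC : IsInitialSegment simplicialKey C) : #(cubeInterior C) ≤ #(hammingBall k (i + 1)) := by
  obtain ⟨hcard, hlt⟩ := isHCR_iff.1 h
  rcases (Nat.succ_le_of_lt h.radius_lt).lt_or_eq with hik | rfl
  · rw [← cubeInterior_hammingBall hik]
    refine card_le_card (cubeInterior_mono
      (hC.subset_of_card_le (isInitialSegment_hammingBall k (i + 2)) ?_))
    rw [card_hammingBall_succ k (i + 1)]
    omega
  · rw [Nat.choose_self, Nat.lt_one_iff] at hlt
    exact (card_le_card (cubeInterior_subset C)).trans (by omega)

theorem IsHCR.card_cubeInterior_of_choose_add {C : Finset (Fin (k + 1) → Bool)}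
    (h : IsHCR (k + 1) #C i (k.choose i + r)) (hC : IsInitialSegment simplicialKey C) :
    #(cubeInterior C) = #(hammingBall k i) + #(cubeInterior (cubeSlice 0 false C)) := by
  have hF := h.isHCR_cubeSlice_false hC
  rw [hC.card_cubeInterior_eq_add_min 0,
    h.cubeSlice_true_eq_hammingBall hC (Nat.le_add_right _ _),
    cubeInterior_hammingBall hF.radius_lt, min_eq_left (hF.card_cubeInterior_le (hC.slice 0 false))]

theorem IsHCR.card_cubeInterior {C : Finset (Fin k → Bool)} (h : IsHCR k #C i m)
    (hC : IsInitialSegment simplicialKey C) :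
    #(cubeInterior C) = #(hammingBall k i) + upperBoundary m (k - i - 1) := by
  induction k generalizing i m with
  | zero => exact absurd h.2 (by simp)
  | succ k ih =>
    rcases lt_or_ge m (k.choose i) with hm | hm
    · rw [h.card_cubeInterior_of_lt hC hm]
      cases i with
      | zero =>
        have hT : cubeSlice 0 true C = ∅ := by
          rw [← card_eq_zero, h.card_cubeSlice_true hC hm.le]
          simpa [hammingBall] using hm
        obtain rfl : m = 0 := by simpa using hm
        rw [hT, subset_empty.1 (cubeInterior_subset ∅)]
        simp [hammingBall, upperBoundary_zero]
      | succ i =>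
        have hT : IsHCR k #(cubeSlice 0 true C) i m :=
          isHCR_iff.2 ⟨h.card_cubeSlice_true hC hm.le, hm⟩
        rw [ih hT (hC.slice 0 true), card_hammingBall_succ_succ, Nat.add_sub_add_right]
        ring
    · obtain ⟨r, rfl⟩ := Nat.exists_eq_add_of_le hm
      have hF := h.isHCR_cubeSlice_false hC
      have hball := two_mul_card_hammingBall hF.radius_lt.le
      rw [h.card_cubeInterior_of_choose_add hC, ih hF (hC.slice 0 false),
        show k + 1 - i - 1 = k - i by omega, upperBoundary_choose_symm_add hF.2]
      omega

end InitialSegmentInterior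

theorem maxFull_eq_card_cubeInterior {k : ℕ} {C : Finset (Fin k → Bool)}
    (hC : IsInitialSegment simplicialKey C) : maxFull k #C = #(cubeInterior C) := by
  refine le_antisymm (Finset.sup_le fun S hS => ?_) ?_
  · rw [fullCount_eq_card_cubeInterior]
    exact hC.card_cubeInterior_le (mem_powersetCard.1 hS).2.symm
  · rw [← fullCount_eq_card_cubeInterior]
    exact le_sup (f := fullCount k) (mem_powersetCard.2 ⟨subset_univ C, rfl⟩)

theorem maxFull_two_pow (k : ℕ) : maxFull k (2 ^ k) = 2 ^ k := by
  have huniv : IsInitialSegment simplicialKey (univ : Finset (Fin k → Bool)) :=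
    fun _ _ x _ => mem_univ x
  simpa [cubeInterior_univ] using maxFull_eq_card_cubeInterior huniv

theorem maxFull_eq_of_isHCR {k n i m : ℕ} (hn : n ≤ 2 ^ k) (h : IsHCR k n i m) :
    maxFull k n = ∑ l ∈ range i, k.choose l + upperBoundary m (k - i - 1) := by
  have hC := isInitialSegment_initialSegment (simplicialKey : (Fin k → Bool) → _) n
  have hcard := card_initialSegment (simplicialKey_injective (k := k)) (n := n) (by simpa using hn)
  rw [← hcard] at h
  rw [← hcard, maxFull_eq_card_cubeInterior hC, h.card_cubeInterior hC, card_hammingBall]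

section Representation

variable {k n : ℕ}

theorem IsHCR.unique {i i' m m' : ℕ} (h : IsHCR k n i m) (h' : IsHCR k n i' m') :
    i = i' ∧ m = m' := by
  have radius_le : ∀ {a b u v : ℕ}, IsHCR k n a u → IsHCR k n b v → a ≤ b := by
    rintro a b u v ⟨ha, -⟩ ⟨hb, hv⟩
    by_contra! hlt
    have hmono : ∑ l ∈ range (b + 1 + 1), k.choose l ≤ ∑ l ∈ range (a + 1), k.choose l :=
      sum_le_sum_of_subset (range_subset_range.2 (by omega))
    rw [sum_range_succ] at hmono
    omega
  obtain rfl := le_antisymm (radius_le h h') (radius_le h' h)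
  exact ⟨rfl, Nat.add_left_cancel (h.1.symm.trans h'.1)⟩

theorem exists_isHCR (hn : 1 ≤ n) (hn' : n < 2 ^ k) : ∃ i m, IsHCR k n i m := by
  by_contra! hno
  have hle : ∀ i, ∑ l ∈ range (i + 1), k.choose l ≤ n := by
    intro i
    induction i with
    | zero => simpa using hn
    | succ i ih =>
      obtain ⟨m, rfl⟩ := Nat.exists_eq_add_of_le ih
      rw [sum_range_succ]
      exact Nat.add_le_add_left (not_lt.1 fun hm => hno i m ⟨rfl, hm⟩) _
  exact (hle k).not_gt ((Nat.sum_range_choose k).symm ▸ hn')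

end Representation

theorem theorem3p2 (k n : ℕ) (hk : 1 ≤ k) (hn : 1 ≤ n) (hn' : n ≤ 2 ^ k) :
    (n < 2 ^ k → ∃! p : ℕ × ℕ, IsHCR k n p.1 p.2) ∧
    (∀ i m : ℕ, IsHCR k n i m →
      maxFull k n = (∑ l ∈ Finset.range i, k.choose l) + upperBoundary m (k - i - 1)) ∧
    (n = 2 ^ k → maxFull k n = 2 ^ k) := by
  refine ⟨fun hlt => ?_, fun i m h => maxFull_eq_of_isHCR hn' h, fun h => h ▸ maxFull_two_pow k⟩
  obtain ⟨i, m, h⟩ := exists_isHCR hn hlt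
  exact ⟨(i, m), h, fun p hp => Prod.ext_iff.2 (hp.unique h)⟩
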